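/- Let $n,m,t\ge 0$ be integers, let $\mathbb F_q$ be a finite field, and let $A_1,\dots,A_m\subseteq[n]$ be arbitrary sets (the storage structure). There are $n$ storage nodes, $m$ secrets, and one user for each $t$-subset $T\subseteq[m]$, who demands the secrets $s_j$, $j\in T$, and has access to all nodes in $\bigcup_{j\in T}A_j$. The secrets $s_j\in\mathbb F_q^{r_j}$ are mutually independent and uniformly distributed. A protocol consists of a (possibly randomized) encoder mapping $(s_1,\dots,s_m)$ to a vector of finitely many shares in $\mathbb F_q$, a storage profile specifying which shares are stored in which node, with at most $K\ge1$ shares in each node, and decoders recovering, without error, each $s_j$ from the shares stored in the nodes of $A_j$. It is weakly secure if $H(s_\ell\mid U_T)=H(s_\ell)$ for every $t$-subset $T\subseteq[m]$ and every $\ell\in[m]\setminus T$, where $U_T$ denotes all shares stored in the nodes of $\bigcup_{j\in T}A_j$. Its rate tuple is $(r_1/K,\dots,r_m/K)$. The capacity region is the closure in $\mathbb R^m$ of the set of rate tuples of all weakly secure protocols over $\mathbb F_q$ (with arbitrary $K\geq 1$ and $r_1,\dots,r_m\ge 0$). Then the capacity region is the convex hull of the set of all $(R_1,\dots,R_m)\in\mathbb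 R_{\ge0}^m$ satisfying $$R_j\le\Bigl|A_j\setminus\bigcup_{j'\in S}A_{j'}\Bigr|\quad\text{for all } j\in[m],\ S\subseteq[m]\setminus\{j\},\ |S|=t,$$ $$\sum_{i\in S}R_i\le\Bigl|\bigcup_{i\in S}A_i\Bigr|\quad\text{for all } S\subseteq[m].$$ -/

import Mathlib

namespace DMUSS

/-! ### Shannon entropy on finite types -/

/-- Shannon entropy `H(X) = -∑ p(a) log p(a)` of a random variable with law `p`. -/
noncomputable def entropy {α : Type*} [Fintype α] (p : PMF α) : ℝ :=
  ∑ a, Real.negMulLog (p a).toReal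

/-- Conditional entropy `H(X | Y) = ∑ p(a,b) log (p(b) / p(a,b))` of a pair `(X, Y)` with joint
law `p`. Terms with `p(a,b) = 0` contribute `0`. -/
noncomputable def condEntropy {α β : Type*} [Fintype α] [Fintype β] (p : PMF (α × β)) : ℝ :=
  ∑ a, ∑ b, (p (a, b)).toReal * Real.log ((p.map Prod.snd b).toReal / (p (a, b)).toReal)

/-! ### Secret sharing protocols -/

/-- The tuples of `m` secrets, where the `j`-th secret consists of `r j` symbols of `F`. -/
abbrev Secrets (F : Type*) {m : ℕ} (r : Fin m → ℕ) : Type _ :=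
  (j : Fin m) → Fin (r j) → F

/-- Indices of all shares that are stored in the nodes of `B`, where `store i` is the set of
(indices of) shares stored in node `i`. -/
def visible {n h : ℕ} (store : Fin n → Finset (Fin h)) (B : Finset (Fin n)) : Finset (Fin h) :=
  B.biUnion store

/-- The data read off the nodes of `B` when the vector of all shares is `y`. -/
def view {F : Type*} {n h : ℕ} (store : Fin n → Finset (Fin h)) (B : Finset (Fin n))
    (y : Fin h → F) : visible store B → F :=
  fun k => y k

/-- A distributed secret sharing protocol over `F` with `n` storage nodes and `m` secrets, storage
structure `A` and secret lengths `r`: a (randomized) encoder of the secrets into `h` shares, a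
storage profile, and one decoder per secret, acting on the shares in the storage set of that
secret. -/
structure Protocol (F : Type*) {n m : ℕ} (A : Fin m → Finset (Fin n)) (r : Fin m → ℕ) where
  /-- number of shares -/
  h : ℕ
  /-- storage profile: share `k` is stored in node `i` iff `k ∈ store i` -/
  store : Fin n → Finset (Fin h)
  /-- encoder; `enc s` is the conditional law of the share vector given the secrets `s` -/
  enc : Secrets F r → PMF (Fin h → F)
  /-- decoders -/
  dec : (j : Fin m) → (visible store (A j) → F) → (Fin (r j) → F)

namespace Protocol

variable {F : Type*} {n m : ℕ} {A : Fin m → Finset (Fin n)} {r : Fin m → ℕ}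

/-- Every storage node holds at most `K` symbols. -/
def HasNodeSize (P : Protocol F A r) (K : ℕ) : Prop :=
  ∀ i, (P.store i).card ≤ K

/-- Correctness: each secret is recovered, without error, from the data in its storage set. -/
def Correct (P : Protocol F A r) : Prop :=
  ∀ s, ∀ y ∈ (P.enc s).support, ∀ j, P.dec j (view P.store (A j) y) = s j

/-- Joint law of the secrets and the shares: the secrets are independent and uniform. -/
noncomputable def joint [Fintype F] [Nonempty F] (P : Protocol F A r) :
    PMF (Secrets F r × (Fin P.h → F)) :=
  (PMF.uniformOfFintype (Secrets F r)).bind fun s => (P.enc s).map fun y => (s, y)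

/-- The data accessible to the user who demands the secrets in `S`: the content of all nodes in
`⋃ j ∈ S, A j`. -/
def userView (P : Protocol F A r) (S : Finset (Fin m)) (y : Fin P.h → F) :
    visible P.store (S.biUnion A) → F :=
  view P.store (S.biUnion A) y

/-- Weak secrecy, when there is one user for every set of `t` secrets:
`H(s_l | U_S) = H(s_l)` for every user `S` and every secret `l` not demanded by that user. -/
def WeaklySecure [Fintype F] [Nonempty F] (P : Protocol F A r) (t : ℕ) : Prop :=
  ∀ S : Finset (Fin m), S.card = t → ∀ l, l ∉ S →
    condEntropy (P.joint.map fun x => (x.1 l, P.userView S x.2)) =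
      entropy (P.joint.map fun x => x.1 l)

end Protocol

/-- `R` is the rate tuple of some correct, weakly secure protocol: `R j = r j / K`, where `r j` is
the length of the `j`-th secret and `K ≥ 1` is the size of each storage node. -/
def IsProtocolRate (F : Type*) [Fintype F] [Nonempty F] {n m : ℕ}
    (A : Fin m → Finset (Fin n)) (t : ℕ) (R : Fin m → ℝ) : Prop :=
  ∃ (K : ℕ) (r : Fin m → ℕ) (P : Protocol F A r),
    0 < K ∧ P.HasNodeSize K ∧ P.Correct ∧ P.WeaklySecure t ∧ ∀ j, R j = (r j : ℝ) / (K : ℝ)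

/-- The capacity region: a tuple of real rates is achievable if it is approximated arbitrarily
well by the rate tuples of correct and weakly secure protocols. -/
def capacityRegion (F : Type*) [Fintype F] [Nonempty F] {n m : ℕ}
    (A : Fin m → Finset (Fin n)) (t : ℕ) : Set (Fin m → ℝ) :=
  closure {R | IsProtocolRate F A t R}

end DMUSS

/-!
Converse: by correctness, the shares in the nodes of `⋃ j ∈ S, A j` determine the secrets in `S`, so
counting share vectors gives the storage inequality. Moreover, given what a user `S` sees, the
secret `l` takes at most `|F| ^ (K * |A l \ ⋃ j ∈ S, A j|)` values, while by weak secrecy its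
conditional entropy is still that of a uniform element of `F ^ r l`.

Achievability: it suffices to realize the rates `r j / K` in the region, since these are dense.
Store uniform symbols of an extension field of `F`, conditioned on secret `j` being the product of
the stored vector with the `j`-th block of columns of a generic matrix, supported on the rows of
`A j`. The extension is finite but large enough that every square submatrix whose support contains
a perfect matching is invertible. Hall's theorem turns the storage inequalities into a matching of
all symbols of the secrets into the storage, so every tuple of secrets can be encoded. The secrecy
inequalities allow matching the symbols of the secret `l` into nodes that the user `S` does not see,
so the secret and the view of this user are independent.
-/

namespace DMUSS

section Uniform

theorem eq_uniformOfFintype_of_forall_eq {α : Type*} [Fintype α] [Nonempty α] {p : PMF α}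
    (h : ∀ a b, p a = p b) : p = PMF.uniformOfFintype α := by
  ext a
  have hsum : ∑ b, p b = 1 := by rw [← tsum_fintype (L := .unconditional _), p.tsum_coe]
  simp only [h _ a, Finset.sum_const, Finset.card_univ, nsmul_eq_mul] at hsum
  rw [PMF.uniformOfFintype_apply]
  exact ENNReal.eq_inv_of_mul_eq_one_left (by rwa [mul_comm])

variable {α β : Type*} [Fintype α] [Fintype β] [Nonempty α] [Nonempty β]

theorem uniformOfFintype_bind_fiber [DecidableEq β] (f : α → β) [∀ b, Nonempty {a // f a = b}]
    (hf : ∀ b b', Fintype.card {a // f a = b} = Fintype.card {a // f a = b'}) :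
    ((PMF.uniformOfFintype β).bind fun b =>
      (PMF.uniformOfFintype {a // f a = b}).map Subtype.val) = PMF.uniformOfFintype α := by
  classical
  have hval : ∀ b a, (PMF.uniformOfFintype {a // f a = b}).map Subtype.val a =
      if b = f a then (Fintype.card {a // f a = b} : ENNReal)⁻¹ else 0 := by
    intro b a
    rw [PMF.map_apply]
    split_ifs with h
    · rw [tsum_eq_single ⟨a, h.symm⟩ fun a' ha' => if_neg fun h' => ha' (Subtype.ext h'.symm)]
      simp only [if_true, PMF.uniformOfFintype_apply]
    · exact ENNReal.tsum_eq_zero.2 fun a' => if_neg fun h' => h (by rw [h', a'.2])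
  refine eq_uniformOfFintype_of_forall_eq fun a a' => ?_
  simp only [PMF.bind_apply, hval, PMF.uniformOfFintype_apply, mul_ite, mul_zero, tsum_ite_eq,
    hf (f a) (f a')]

theorem map_uniformOfFintype_of_card_fiber_eq [DecidableEq β] {f : α → β}
    (hsurj : Function.Surjective f)
    (hf : ∀ b b', Fintype.card {a // f a = b} = Fintype.card {a // f a = b'}) :
    (PMF.uniformOfFintype α).map f = PMF.uniformOfFintype β := by
  have (b : β) : Nonempty {a // f a = b} := nonempty_subtype.2 (hsurj b)
  rw [← uniformOfFintype_bind_fiber f hf, PMF.map_bind]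
  refine (congrArg _ (funext fun b => ?_)).trans (PMF.bind_pure _)
  rw [PMF.map_comp, ← PMF.map_const (PMF.uniformOfFintype {a // f a = b}) b]
  exact congrArg (PMF.map · _) (funext Subtype.prop)

theorem map_uniformOfFintype_equiv (e : α ≃ β) :
    (PMF.uniformOfFintype α).map e = PMF.uniformOfFintype β := by
  classical
  refine map_uniformOfFintype_of_card_fiber_eq e.surjective fun b b' => ?_
  simp only [← e.eq_symm_apply, Fintype.card_subtype_eq]

theorem card_fiber_eq_of_surjective {G H : Type*} [AddGroup G] [AddGroup H] [Fintype G]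
    [DecidableEq H] {f : G →+ H} (hf : Function.Surjective f) (b b' : H) :
    Fintype.card {a // f a = b} = Fintype.card {a // f a = b'} := by
  simpa only [Fintype.card_subtype] using
    AddMonoidHom.card_fiber_eq_of_mem_range f (hf b) (hf b')

end Uniform

section Product

variable {α β γ δ : Type*}

/-- The law of a pair of independent random variables with laws `p` and `q`. -/
noncomputable def prodPMF (p : PMF α) (q : PMF β) : PMF (α × β) :=
  p.bind fun a => q.map (Prod.mk a)

theorem prodPMF_apply (p : PMF α) (q : PMF β) (a : α) (b : β) :
    prodPMF p q (a, b) = p a * q b := by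
  classical
  have hq : ∀ a', q.map (Prod.mk a') (a, b) = if a' = a then q b else 0 := by
    intro a'
    rw [PMF.map_apply]
    split_ifs with h
    · simp [h]
    · simp [Ne.symm h]
  simp only [prodPMF, PMF.bind_apply, hq, mul_ite, mul_zero, tsum_ite_eq]

theorem map_prodMap_prodPMF (f : α → γ) (g : β → δ) (p : PMF α) (q : PMF β) :
    (prodPMF p q).map (Prod.map f g) = prodPMF (p.map f) (q.map g) := by
  simp only [prodPMF, PMF.map_bind, PMF.bind_map, PMF.map_comp, Function.comp_def, Prod.map_apply]

theorem map_fst_prodPMF (p : PMF α) (q : PMF β) : (prodPMF p q).map Prod.fst = p := by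
  simp only [prodPMF, PMF.map_bind, PMF.map_comp]
  exact (congrArg p.bind (funext fun a => PMF.map_const q a)).trans (PMF.bind_pure p)

theorem map_snd_prodPMF (p : PMF α) (q : PMF β) : (prodPMF p q).map Prod.snd = q := by
  simp only [prodPMF, PMF.map_bind, PMF.map_comp]
  exact (congrArg p.bind (funext fun _ => PMF.map_id q)).trans (PMF.bind_const p q)

theorem prodPMF_uniformOfFintype [Fintype α] [Fintype β] [Nonempty α] [Nonempty β] :
    prodPMF (PMF.uniformOfFintype α) (PMF.uniformOfFintype β) = PMF.uniformOfFintype (α × β) :=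
  eq_uniformOfFintype_of_forall_eq fun (_, _) (_, _) => by
    simp only [prodPMF_apply, PMF.uniformOfFintype_apply]

end Product

section Entropy

variable {α β : Type*} [Fintype α]

theorem sum_toReal_eq_one (p : PMF α) : ∑ a, (p a).toReal = 1 := by
  rw [← ENNReal.toReal_sum fun a _ => p.apply_ne_top a, ← tsum_fintype (L := .unconditional _),
    p.tsum_coe, ENNReal.toReal_one]

theorem entropy_uniformOfFintype [Nonempty α] :
    entropy (PMF.uniformOfFintype α) = Real.log (Fintype.card α) := by
  simp [entropy, Real.negMulLog]

theorem sum_mul_log_sum_div_le_sum_mul_log_card {ι : Type*} (s : Finset ι) {u : ι → ℝ}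
    (hu : ∀ i ∈ s, 0 ≤ u i) :
    ∑ i ∈ s, u i * Real.log ((∑ j ∈ s, u j) / u i) ≤ (∑ i ∈ s, u i) * Real.log s.card := by
  obtain rfl | hs := s.eq_empty_or_nonempty
  · simp
  set U := ∑ j ∈ s, u j
  have hcard : (0 : ℝ) < s.card := by exact_mod_cast hs.card_pos
  have hterm : ∀ i ∈ s, u i * Real.log (U / u i) = u i * Real.log U + Real.negMulLog (u i) := by
    intro i hi
    obtain h | h := (hu i hi).eq_or_lt
    · simp [← h]
    · have hU : 0 < U := h.trans_le (Finset.single_le_sum hu hi)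
      rw [Real.log_div hU.ne' h.ne', Real.negMulLog]
      ring
  have hjensen : ∑ i ∈ s, Real.negMulLog (u i) ≤ s.card * Real.negMulLog (U / s.card) := by
    have h := Real.concaveOn_negMulLog.le_map_sum (t := s) (w := fun _ => (s.card : ℝ)⁻¹) (p := u)
      (fun _ _ => by positivity) (by simp [hcard.ne']) hu
    simp only [smul_eq_mul, ← Finset.mul_sum] at h
    rwa [inv_mul_le_iff₀ hcard, inv_mul_eq_div] at h
  calc ∑ i ∈ s, u i * Real.log (U / u i)
      = U * Real.log U + ∑ i ∈ s, Real.negMulLog (u i) := by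
        rw [Finset.sum_congr rfl hterm, Finset.sum_add_distrib, ← Finset.sum_mul]
    _ ≤ U * Real.log U + s.card * Real.negMulLog (U / s.card) := by gcongr
    _ = U * Real.log s.card := by
        obtain h | h := eq_or_ne U 0
        · simp [h]
        · rw [Real.negMulLog, Real.log_div h hcard.ne']
          field_simp
          ring

theorem toReal_map_snd_apply (p : PMF (α × β)) (b : β) :
    (p.map Prod.snd b).toReal = ∑ a, (p (a, b)).toReal := by
  classical
  rw [← ENNReal.toReal_sum fun a _ => p.apply_ne_top _, PMF.map_apply,
    ENNReal.tsum_prod (f := fun a b' => if b = b' then p (a, b') else 0), tsum_fintype]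
  simp only [eq_comm (a := b), tsum_ite_eq]

variable [Fintype β]

theorem condEntropy_prodPMF (p : PMF α) (q : PMF β) : condEntropy (prodPMF p q) = entropy p := by
  have hterm : ∀ a b, (p a * q b).toReal * Real.log ((q b).toReal / (p a * q b).toReal) =
      Real.negMulLog (p a).toReal * (q b).toReal := by
    intro a b
    rw [ENNReal.toReal_mul]
    obtain hb | hb := eq_or_ne (q b).toReal 0
    · simp [hb]
    · rw [div_mul_cancel_right₀ hb, Real.log_inv, Real.negMulLog]
      ring
  simp only [condEntropy, entropy, map_snd_prodPMF, prodPMF_apply, hterm, ← Finset.mul_sum,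
    sum_toReal_eq_one, mul_one]

theorem condEntropy_le_log (p : PMF (α × β)) {N : ℕ}
    (hN : ∀ b, Finset.card {a | p (a, b) ≠ 0} ≤ N) : condEntropy p ≤ Real.log N := by
  classical
  set q : β → ℝ := fun b => (p.map Prod.snd b).toReal with hq
  have hfiber : ∀ b, ∑ a, (p (a, b)).toReal * Real.log (q b / (p (a, b)).toReal) ≤
      q b * Real.log N := by
    intro b
    set s : Finset α := {a | p (a, b) ≠ 0} with hs
    have hlog : Real.log s.card ≤ Real.log N := by
      obtain h | h := s.card.eq_zero_or_pos
      · simp [h, Real.log_natCast_nonneg]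
      · exact Real.log_le_log (by exact_mod_cast h) (by exact_mod_cast hN b)
    have hsum : ∀ g : α → ℝ, (∀ a, p (a, b) = 0 → g a = 0) → ∑ a, g a = ∑ a ∈ s, g a :=
      fun g hg => (Finset.sum_subset s.subset_univ fun a _ ha => hg a (by simpa [hs] using ha)).symm
    have hqs : q b = ∑ a ∈ s, (p (a, b)).toReal := by
      rw [hq, ← hsum _ fun a ha => by simp [ha]]
      exact toReal_map_snd_apply p b
    rw [hsum _ fun a ha => by simp [ha], hqs]
    refine (sum_mul_log_sum_div_le_sum_mul_log_card s fun _ _ => ENNReal.toReal_nonneg).trans ?_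
    exact mul_le_mul_of_nonneg_left hlog (Finset.sum_nonneg fun _ _ => ENNReal.toReal_nonneg)
  calc condEntropy p = ∑ b, ∑ a, (p (a, b)).toReal * Real.log (q b / (p (a, b)).toReal) :=
        Finset.sum_comm
    _ ≤ ∑ b, q b * Real.log N := Finset.sum_le_sum fun b _ => hfiber b
    _ = Real.log N := by rw [← Finset.sum_mul, sum_toReal_eq_one, one_mul]

end Entropy

section Visible

variable {n h : ℕ} {store : Fin n → Finset (Fin h)}

theorem card_visible_le {K : ℕ} (hK : ∀ i, (store i).card ≤ K) (B : Finset (Fin n)) :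
    (visible store B).card ≤ K * B.card := by
  rw [mul_comm]
  exact Finset.card_biUnion_le_card_mul _ _ _ fun i _ => hK i

theorem visible_mono {B C : Finset (Fin n)} (hBC : B ⊆ C) : visible store B ⊆ visible store C :=
  Finset.biUnion_subset_biUnion_of_subset_left store hBC

theorem visible_union (B C : Finset (Fin n)) :
    visible store (B ∪ C) = visible store B ∪ visible store C :=
  Finset.union_biUnion

theorem view_eq_view_iff {F : Type*} {B : Finset (Fin n)} {y y' : Fin h → F} :
    view store B y = view store B y' ↔ ∀ k ∈ visible store B, y k = y' k := by
  simp only [funext_iff, Subtype.forall, view]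

theorem card_view_le {F : Type*} [Fintype F] [Nonempty F] {K : ℕ}
    (hK : ∀ i, (store i).card ≤ K) (B : Finset (Fin n)) :
    Fintype.card (visible store B → F) ≤ Fintype.card F ^ (K * B.card) := by
  rw [Fintype.card_fun, Fintype.card_coe]
  exact Nat.pow_le_pow_right Fintype.card_pos (card_visible_le hK B)

end Visible

namespace Protocol

variable {F : Type*} {n m : ℕ} {A : Fin m → Finset (Fin n)} {r : Fin m → ℕ} {P : Protocol F A r}

theorem Correct.eq_of_forall_visible (hc : P.Correct) {s s' : Secrets F r} {y y' : Fin P.h → F}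
    (hy : y ∈ (P.enc s).support) (hy' : y' ∈ (P.enc s').support) {j : Fin m}
    (h : ∀ k ∈ visible P.store (A j), y k = y' k) : s j = s' j := by
  rw [← hc s y hy j, ← hc s' y' hy' j, view_eq_view_iff.2 h]

theorem mem_support_joint_iff [Fintype F] [Nonempty F] {s : Secrets F r} {y : Fin P.h → F} :
    (s, y) ∈ P.joint.support ↔ y ∈ (P.enc s).support := by
  simp [joint]

theorem joint_map_secret [Fintype F] [Nonempty F] (P : Protocol F A r) (l : Fin m) :
    (P.joint.map fun x => x.1 l) = PMF.uniformOfFintype (Fin (r l) → F) := by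
  have hsecrets : P.joint.map Prod.fst = PMF.uniformOfFintype (Secrets F r) := by
    simp only [joint, PMF.map_bind, PMF.map_comp]
    exact (congrArg _ (funext fun s => PMF.map_const (P.enc s) s)).trans (PMF.bind_pure _)
  calc (P.joint.map fun x => x.1 l)
      = ((P.joint.map Prod.fst).map (Equiv.piSplitAt l fun j => Fin (r j) → F)).map Prod.fst := by
        simp only [PMF.map_comp]
        rfl
    _ = PMF.uniformOfFintype (Fin (r l) → F) := by
        rw [hsecrets, map_uniformOfFintype_equiv, ← prodPMF_uniformOfFintype, map_fst_prodPMF]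

/-- Given what the user `S` sees, the secret `l` is determined by the content of the nodes of
`A l` that this user cannot access. -/
theorem Correct.card_secret_given_view_le [Fintype F] [Nonempty F] (hc : P.Correct)
    {K : ℕ} (hK : P.HasNodeSize K) (S : Finset (Fin m)) (l : Fin m)
    (u : visible P.store (S.biUnion A) → F) :
    Finset.card {a | (P.joint.map fun x => (x.1 l, P.userView S x.2)) (a, u) ≠ 0} ≤
      Fintype.card F ^ (K * (A l \ S.biUnion A).card) := by
  have hmem : ∀ a : {a | (P.joint.map fun x => (x.1 l, P.userView S x.2)) (a, u) ≠ 0},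
      ∃ s y, y ∈ (P.enc s).support ∧ s l = a ∧ P.userView S y = u := by
    rintro ⟨a, ha⟩
    obtain ⟨⟨s, y⟩, hsy, he⟩ := (PMF.mem_support_map_iff _ _ _).1 ((PMF.mem_support_iff _ _).2 ha)
    exact ⟨s, y, mem_support_joint_iff.1 hsy, Prod.mk.inj he⟩
  choose s y hy hsl hu using hmem
  have hinj : Function.Injective fun a => view P.store (A l \ S.biUnion A) (y a) := by
    intro a a' haa'
    rw [Subtype.ext_iff, ← hsl a, ← hsl a']
    refine hc.eq_of_forall_visible (hy a) (hy a') fun k hk => ?_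
    have hk' : k ∈ visible P.store (A l \ S.biUnion A) ∪ visible P.store (S.biUnion A) := by
      rw [← visible_union, Finset.sdiff_union_self_eq_union]
      exact visible_mono Finset.subset_union_left hk
    obtain hk' | hk' := Finset.mem_union.1 hk'
    · exact view_eq_view_iff.1 haa' k hk'
    · exact view_eq_view_iff.1 ((hu a).trans (hu a').symm) k hk'
  rw [← Fintype.card_subtype]
  exact (Fintype.card_le_of_injective _ hinj).trans (card_view_le hK _)

theorem weaklySecure_of_map_joint_eq_prodPMF [Fintype F] [Nonempty F] {t : ℕ}
    (h : ∀ S : Finset (Fin m), S.card = t → ∀ l ∉ S, ∃ p q,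
      (P.joint.map fun x => (x.1 l, P.userView S x.2)) = prodPMF p q) : P.WeaklySecure t := by
  intro S hS l hl
  obtain ⟨p, q, hpq⟩ := h S hS l hl
  have hsecret : (P.joint.map fun x => x.1 l) = p := by
    rw [← map_fst_prodPMF p q, ← hpq, PMF.map_comp]
    rfl
  rw [hpq, hsecret, condEntropy_prodPMF]

theorem WeaklySecure.length_le [Fintype F] [Nontrivial F] {t : ℕ} (hs : P.WeaklySecure t)
    (hc : P.Correct) {K : ℕ} (hK : P.HasNodeSize K) {S : Finset (Fin m)} (hS : S.card = t)
    {l : Fin m} (hl : l ∉ S) :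
    r l ≤ K * (A l \ S.biUnion A).card := by
  have hlog : Real.log (Fintype.card (Fin (r l) → F)) ≤
      Real.log (Fintype.card F ^ (K * (A l \ S.biUnion A).card) : ℕ) := by
    rw [← entropy_uniformOfFintype, ← P.joint_map_secret, ← hs S hS l hl]
    exact condEntropy_le_log _ (hc.card_secret_given_view_le hK S l)
  rw [Fintype.card_fun, Fintype.card_fin, Nat.cast_pow, Nat.cast_pow, Real.log_pow, Real.log_pow]
    at hlog
  have hpos : 0 < Real.log (Fintype.card F) :=
    Real.log_pos (by exact_mod_cast Fintype.one_lt_card)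
  exact_mod_cast le_of_mul_le_mul_right hlog hpos

theorem Correct.sum_length_le [Finite F] [Nontrivial F] (hc : P.Correct)
    {K : ℕ} (hK : P.HasNodeSize K) (S : Finset (Fin m)) :
    ∑ j ∈ S, r j ≤ K * (S.biUnion A).card := by
  have := Fintype.ofFinite F
  choose y hy using fun s => (P.enc s).support_nonempty
  let extend : ((j : S) → Fin (r j) → F) → Secrets F r :=
    Function.surjInv (Subtype.surjective_restrict (β := fun j => Fin (r j) → F) (· ∈ S))
  have hextend : ∀ s (j : S), extend s j = s j := fun s j => congrFun
    (Function.surjInv_eq (Subtype.surjective_restrict (β := fun j => Fin (r j) → F) (· ∈ S)) s) j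
  have hinj : Function.Injective fun s => view P.store (S.biUnion A) (y (extend s)) := by
    intro s s' hss'
    funext j
    rw [← hextend s, ← hextend s']
    exact hc.eq_of_forall_visible (hy _) (hy _) fun k hk => view_eq_view_iff.1 hss' k
      (visible_mono (Finset.subset_biUnion_of_mem A j.2) hk)
  have hcard := (Fintype.card_le_of_injective _ hinj).trans (card_view_le hK _)
  simp only [Fintype.card_pi, Fintype.card_fin, Finset.prod_const, Finset.card_univ,
    Finset.prod_pow_eq_pow_sum] at hcard
  rwa [Nat.pow_le_pow_iff_right Fintype.one_lt_card, Finset.sum_coe_sort S r] at hcard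

end Protocol

section RateRegion

variable {n m t : ℕ} {A : Fin m → Finset (Fin n)}

/-- The polyhedron of the non-negative rate tuples that satisfy the secrecy and the storage
inequalities. Being convex, it is the convex hull by which the capacity region is described. -/
def rateRegion (A : Fin m → Finset (Fin n)) (t : ℕ) : Set (Fin m → ℝ) :=
  {R | (∀ j, 0 ≤ R j) ∧
    (∀ j, ∀ S : Finset (Fin m), j ∉ S → S.card = t → R j ≤ ((A j \ S.biUnion A).card : ℝ)) ∧
    (∀ S : Finset (Fin m), ∑ i ∈ S, R i ≤ ((S.biUnion A).card : ℝ))}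

theorem isClosed_rateRegion : IsClosed (rateRegion A t) := by
  simp only [rateRegion, Set.ofPred_and, Set.ofPred_forall]
  refine (isClosed_iInter fun j => ?_).inter
    ((isClosed_iInter fun j => isClosed_iInter fun S => isClosed_iInter fun _ =>
      isClosed_iInter fun _ => ?_).inter (isClosed_iInter fun S => ?_))
  · exact isClosed_le continuous_const (continuous_apply j)
  · exact isClosed_le (continuous_apply j) continuous_const
  · exact isClosed_le (by fun_prop) continuous_const

theorem convex_rateRegion : Convex ℝ (rateRegion A t) := by
  simp only [rateRegion, Set.ofPred_and, Set.ofPred_forall]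
  refine (convex_iInter fun j => ?_).inter
    ((convex_iInter fun j => convex_iInter fun S => convex_iInter fun _ =>
      convex_iInter fun _ => ?_).inter (convex_iInter fun S => ?_))
  · exact convex_halfSpace_ge (LinearMap.proj j).isLinear 0
  · exact convex_halfSpace_le (LinearMap.proj j).isLinear _
  · exact convex_halfSpace_le (f := fun R : Fin m → ℝ => ∑ i ∈ S, R i)
      ⟨fun x y => by simp [Finset.sum_add_distrib], fun c x => by simp [Finset.mul_sum]⟩ _

theorem mem_rateRegion_of_le {R R' : Fin m → ℝ} (hR : R ∈ rateRegion A t) (h0 : ∀ j, 0 ≤ R' j)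
    (hle : ∀ j, R' j ≤ R j) : R' ∈ rateRegion A t :=
  ⟨h0, fun j S hj hS => (hle j).trans (hR.2.1 j S hj hS),
    fun S => (Finset.sum_le_sum fun i _ => hle i).trans (hR.2.2 S)⟩

theorem natCast_div_mem_rateRegion_iff {K : ℕ} (hK : 0 < K) {r : Fin m → ℕ} :
    (fun j => (r j : ℝ) / K) ∈ rateRegion A t ↔
      (∀ j, ∀ S : Finset (Fin m), j ∉ S → S.card = t → r j ≤ K * (A j \ S.biUnion A).card) ∧
      ∀ S : Finset (Fin m), ∑ i ∈ S, r i ≤ K * (S.biUnion A).card := by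
  have hle : ∀ a b : ℕ, (a : ℝ) / K ≤ b ↔ a ≤ K * b := fun a b => by
    rw [div_le_iff₀' (by exact_mod_cast hK)]
    exact_mod_cast Iff.rfl
  simp only [rateRegion, Set.mem_ofPred_eq, ← Finset.sum_div, ← Nat.cast_sum, hle]
  exact and_iff_right fun j => by positivity

theorem IsProtocolRate.mem_rateRegion {F : Type*} [Fintype F] [Nontrivial F] {R : Fin m → ℝ}
    (hR : IsProtocolRate F A t R) : R ∈ rateRegion A t := by
  obtain ⟨K, r, P, hK, hP, hc, hs, hR⟩ := hR
  rw [funext hR, natCast_div_mem_rateRegion_iff hK]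
  exact ⟨fun l S hl hS => hs.length_le hc hP hS hl, hc.sum_length_le hP⟩

theorem rateRegion_subset_closure :
    rateRegion A t ⊆ closure {R | R ∈ rateRegion A t ∧
      ∃ (K : ℕ) (r : Fin m → ℕ), 0 < K ∧ R = fun j => (r j : ℝ) / K} := by
  intro R hR
  refine mem_closure_of_tendsto (b := Filter.atTop)
    (f := fun (K : ℕ) j => (⌊R j * K⌋₊ : ℝ) / K) (tendsto_pi_nhds.2 fun j => ?_) ?_
  · exact (tendsto_nat_floor_mul_div_atTop (hR.1 j)).comp tendsto_natCast_atTop_atTop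
  · filter_upwards [Filter.eventually_gt_atTop 0] with K hK
    refine ⟨mem_rateRegion_of_le hR (fun j => by positivity) fun j => ?_, K, _, hK, rfl⟩
    rw [div_le_iff₀ (by exact_mod_cast hK)]
    exact Nat.floor_le (mul_nonneg (hR.1 j) K.cast_nonneg)

end RateRegion

section GenericMatrix

open scoped Matrix

variable {ρ γ : Type*} {allowed : ρ → γ → Prop}

/-- A matrix supported on `allowed` is generic if its square submatrices are invertible as soon as
`allowed` has a perfect matching between their rows and their columns (listed in the order of such a
matching). A user then learns nothing about the secrets that unseen shares can still change. -/
structure IsGeneric {E : Type*} [CommRing E] (allowed : ρ → γ → Prop) (G : Matrix ρ γ E) :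
    Prop where
  eq_zero : ∀ i c, ¬ allowed i c → G i c = 0
  det_ne_zero : ∀ (k : ℕ) (f : Fin k → ρ) (g : Fin k → γ), Function.Injective f →
    Function.Injective g → (∀ a, allowed (f a) (g a)) → (G.submatrix f g).det ≠ 0

theorem exists_aeval_ne_zero (F : Type*) [Field F] {σ : Type*} [Finite σ]
    {p : MvPolynomial σ F} (hp : p ≠ 0) :
    ∃ (E : IntermediateField F (AlgebraicClosure F)) (_ : FiniteDimensional F E) (x : σ → E),
      MvPolynomial.aeval x p ≠ 0 := by
  obtain ⟨x, hx⟩ : ∃ x : σ → AlgebraicClosure F, MvPolynomial.aeval x p ≠ 0 := by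
    by_contra! h
    refine (map_ne_zero_iff _ (MvPolynomial.map_injective _
      (algebraMap F (AlgebraicClosure F)).injective)).2 hp (MvPolynomial.funext fun x => ?_)
    rw [MvPolynomial.eval_map, ← MvPolynomial.aeval_def, h, map_zero]
  let E := IntermediateField.adjoin F (Set.range x)
  let x' : σ → E := fun i => ⟨x i, IntermediateField.subset_adjoin _ _ ⟨i, rfl⟩⟩
  refine ⟨E, IntermediateField.finiteDimensional_adjoin fun a _ =>
    (Algebra.IsAlgebraic.isAlgebraic a).isIntegral, x', fun h => hx ?_⟩
  have hE := congrArg E.val h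
  rw [map_zero] at hE
  rw [← hE]
  exact MvPolynomial.aeval_algebraMap_apply (AlgebraicClosure F) x' p

section PatternMatrix

open scoped Classical in
/-- The matrix with independent indeterminates at the entries in `allowed` and zeros elsewhere. -/
noncomputable def patternMatrix (R : Type*) [CommRing R] (allowed : ρ → γ → Prop) :
    Matrix ρ γ (MvPolynomial (ρ × γ) R) :=
  Matrix.of fun i c => if allowed i c then MvPolynomial.X (i, c) else 0

variable {R : Type*} [CommRing R]

open scoped Classical in
theorem aeval_det_submatrix_patternMatrix {E κ : Type*} [CommRing E] [Algebra R E] [Fintype κ]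
    [DecidableEq κ] (x : ρ × γ → E) (f : κ → ρ) (g : κ → γ) :
    MvPolynomial.aeval x ((patternMatrix R allowed).submatrix f g).det =
      ((Matrix.of fun i c => if allowed i c then x (i, c) else 0).submatrix f g).det := by
  rw [AlgHom.map_det]
  congr 1
  ext a b
  simp only [patternMatrix, AlgHom.mapMatrix_apply, Matrix.map_apply, Matrix.submatrix_apply,
    Matrix.of_apply, apply_ite (MvPolynomial.aeval x), MvPolynomial.aeval_X, map_zero]

theorem det_submatrix_patternMatrix_ne_zero [Nontrivial R] {κ : Type*} [Fintype κ] [DecidableEq κ]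
    {f : κ → ρ} {g : κ → γ} (hf : Function.Injective f) (hg : Function.Injective g)
    (hfg : ∀ a, allowed (f a) (g a)) : ((patternMatrix R allowed).submatrix f g).det ≠ 0 := by
  classical
  intro h0
  have hdet := aeval_det_submatrix_patternMatrix (R := R) (allowed := allowed)
    (fun z => if ∃ a, (f a, g a) = z then (1 : R) else 0) f g
  have hone : (Matrix.of fun i c => if allowed i c then
      if ∃ a, (f a, g a) = (i, c) then (1 : R) else 0 else 0).submatrix f g = 1 := by
    ext a b
    obtain rfl | hab := eq_or_ne a b
    · simpa [hfg] using ⟨a, rfl, rfl⟩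
    · simp [hab, hf.eq_iff, hg.eq_iff]
  rw [h0, map_zero, hone, Matrix.det_one] at hdet
  exact zero_ne_one hdet

end PatternMatrix

theorem exists_isGeneric (F : Type*) [Field F] [Finite ρ] [Finite γ] (allowed : ρ → γ → Prop) :
    ∃ (E : IntermediateField F (AlgebraicClosure F)) (_ : FiniteDimensional F E)
      (G : Matrix ρ γ E), IsGeneric allowed G := by
  classical
  have := Fintype.ofFinite ρ
  have := Fintype.ofFinite γ
  let transversals : Finset (Σ k : Fin (Fintype.card γ + 1), (Fin k ↪ ρ) × (Fin k ↪ γ)) :=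
    {q | ∀ a, allowed (q.2.1 a) (q.2.2 a)}
  let p : MvPolynomial (ρ × γ) F :=
    ∏ q ∈ transversals, ((patternMatrix F allowed).submatrix q.2.1 q.2.2).det
  have hp : p ≠ 0 := Finset.prod_ne_zero_iff.2 fun q hq => det_submatrix_patternMatrix_ne_zero
    q.2.1.injective q.2.2.injective (Finset.mem_filter.1 hq).2
  obtain ⟨E, hE, x, hx⟩ := exists_aeval_ne_zero F hp
  refine ⟨E, hE, Matrix.of fun i c => if allowed i c then x (i, c) else 0,
    fun i c h => if_neg h, fun k f g hf hg hfg => ?_⟩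
  have hk : k < Fintype.card γ + 1 := by
    simpa [Nat.lt_succ_iff] using Fintype.card_le_of_injective g hg
  rw [map_prod, Finset.prod_ne_zero_iff] at hx
  rw [← aeval_det_submatrix_patternMatrix (R := F)]
  exact hx ⟨⟨k, hk⟩, ⟨f, hf⟩, ⟨g, hg⟩⟩ (by simpa [transversals] using hfg)

theorem IsGeneric.exists_vecMul_eq {E κ : Type*} [Field E] [Fintype ρ] [Finite κ]
    {G : Matrix ρ γ E} (hG : IsGeneric allowed G) {f : κ → ρ} {g : κ → γ}
    (hf : Function.Injective f) (hg : Function.Injective g) (hfg : ∀ a, allowed (f a) (g a))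
    (w : κ → E) :
    ∃ y : ρ → E, (∀ i ∉ Set.range f, y i = 0) ∧ ∀ a, (y ᵥ* G) (g a) = w a := by
  classical
  have := Fintype.ofFinite κ
  let e := Fintype.equivFin κ
  have hdet : IsUnit (G.submatrix f g).det := by
    rw [← Matrix.det_submatrix_equiv_self e.symm, Matrix.submatrix_submatrix]
    exact (hG.det_ne_zero _ _ _ (hf.comp e.symm.injective) (hg.comp e.symm.injective)
      fun a => hfg _).isUnit
  let z : κ → E := w ᵥ* (G.submatrix f g)⁻¹
  refine ⟨z ᵥ* (1 : Matrix ρ ρ E).submatrix f id, fun i hi => ?_, fun a => ?_⟩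
  · refine Finset.sum_eq_zero fun a _ => ?_
    change z a * (1 : Matrix ρ ρ E) (f a) i = 0
    rw [Matrix.one_apply_ne fun h => hi ⟨a, h⟩, mul_zero]
  · have hz : z ᵥ* G.submatrix f g = w := by
      rw [Matrix.vecMul_vecMul, Matrix.nonsing_inv_mul _ hdet, Matrix.vecMul_one]
    rw [Matrix.vecMul_vecMul, ← Equiv.coe_refl, Matrix.one_submatrix_mul]
    exact congrFun hz a

end GenericMatrix

section AdditiveScheme

variable {n m t : ℕ} {A : Fin m → Finset (Fin n)}

/-- A scheme in which every node stores one element of a group `V` and the secrets are read off the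
stored data by a group homomorphism `D`. The field `secure` says that, whatever a user sees, every
value of a secret not demanded by that user remains possible. -/
structure IsAdditiveScheme (A : Fin m → Finset (Fin n)) (t : ℕ) {V : Type*} [AddGroup V]
    {W : Fin m → Type*} [∀ j, AddGroup (W j)] (D : (Fin n → V) →+ ∀ j, W j) : Prop where
  surjective : Function.Surjective D
  apply_eq_zero : ∀ j y, (∀ i ∈ A j, y i = 0) → D y j = 0
  secure : ∀ S : Finset (Fin m), S.card = t → ∀ l ∉ S, ∀ w,
    ∃ y, (∀ i ∈ S.biUnion A, y i = 0) ∧ D y l = w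

section Shares

variable {F V : Type*} {K : ℕ}

/-- Encodes the contents `y` of the nodes by `n * K` shares, `K` for each node. -/
def shares (φ : V → Fin K → F) (y : Fin n → V) : Fin (n * K) → F :=
  fun k => φ (y k.divNat) k.modNat

/-- The shares that `shares` produces for node `i`. -/
def nodeShares (n K : ℕ) (i : Fin n) : Finset (Fin (n * K)) :=
  {k | k.divNat = i}

theorem card_nodeShares_le (i : Fin n) : (nodeShares n K i).card ≤ K := by
  have hinj : Set.InjOn Fin.modNat (nodeShares n K i : Set (Fin (n * K))) := fun k hk k' hk' h => by
    have hdiv : k.divNat = k'.divNat :=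
      (Finset.mem_filter.1 hk).2.trans (Finset.mem_filter.1 hk').2.symm
    exact finProdFinEquiv.symm.injective (Prod.ext hdiv h)
  simpa using Finset.card_le_card_of_injOn _ (fun _ _ => Finset.mem_univ _) hinj

theorem mem_visible_nodeShares {B : Finset (Fin n)} {k : Fin (n * K)} :
    k ∈ visible (nodeShares n K) B ↔ k.divNat ∈ B := by
  simp [visible, nodeShares]

theorem view_shares_eq_iff {φ : V ≃ (Fin K → F)} {B : Finset (Fin n)} {y y' : Fin n → V} :
    view (nodeShares n K) B (shares φ y) = view (nodeShares n K) B (shares φ y') ↔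
      ∀ i ∈ B, y i = y' i := by
  simp only [view_eq_view_iff, mem_visible_nodeShares, shares]
  refine ⟨fun h i hi => φ.injective (funext fun a => ?_), fun h k hk => by rw [h _ hk]⟩
  have hk : ((finProdFinEquiv (i, a)).divNat, (finProdFinEquiv (i, a)).modNat) = (i, a) :=
    finProdFinEquiv.symm_apply_apply (i, a)
  obtain ⟨hdiv, hmod⟩ := Prod.mk.inj hk
  have hia := h (finProdFinEquiv (i, a)) (hdiv.symm ▸ hi)
  rwa [hdiv, hmod] at hia

end Shares

namespace IsAdditiveScheme

variable {V : Type*} [AddGroup V] {W : Fin m → Type*} [∀ j, AddGroup (W j)]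
  {D : (Fin n → V) →+ ∀ j, W j} {F : Type*} {K : ℕ} {r : Fin m → ℕ}

theorem nonempty_fiber (hD : IsAdditiveScheme A t D) (ψ : ∀ j, W j ≃ (Fin (r j) → F))
    (s : Secrets F r) : Nonempty {y // (fun j => ψ j (D y j)) = s} :=
  nonempty_subtype.2 <| (hD.surjective fun j => (ψ j).symm (s j)).imp fun _ hy => by
    simp only [hy, Equiv.apply_symm_apply]

theorem surjective_apply_restrict (hD : IsAdditiveScheme A t D) {S : Finset (Fin m)}
    (hS : S.card = t) {l : Fin m} (hl : l ∉ S) :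
    Function.Surjective fun y => (D y l, (S.biUnion A).restrict y) := by
  rintro ⟨w, u⟩
  obtain ⟨y₀, hy₀⟩ := Subtype.surjective_restrict (β := fun _ => V) (· ∈ S.biUnion A) u
  obtain ⟨y, hy, hyl⟩ := hD.secure S hS l hl (w - D y₀ l)
  refine ⟨y + y₀, Prod.ext ?_ (funext fun i => ?_)⟩
  · simp [hyl]
  · simp [hy _ i.2, ← hy₀]

variable [Fintype V]

theorem map_apply_restrict (hD : IsAdditiveScheme A t D) {S : Finset (Fin m)}
    (hS : S.card = t) {l : Fin m} [Fintype (W l)] (hl : l ∉ S) :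
    ((PMF.uniformOfFintype (Fin n → V)).map fun y => (D y l, (S.biUnion A).restrict y)) =
      prodPMF (PMF.uniformOfFintype (W l)) (PMF.uniformOfFintype (S.biUnion A → V)) := by
  classical
  let f : (Fin n → V) →+ W l × (S.biUnion A → V) :=
    { toFun := fun y => (D y l, (S.biUnion A).restrict y)
      map_zero' := by rw [map_zero]; rfl
      map_add' := fun y y' => by rw [map_add]; rfl }
  have hf : Function.Surjective f := hD.surjective_apply_restrict hS hl
  rw [prodPMF_uniformOfFintype]
  exact map_uniformOfFintype_of_card_fiber_eq hf (card_fiber_eq_of_surjective hf)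

open scoped Classical in
/-- The protocol of an additive scheme whose groups are identified with spaces of symbols. The
stored data are uniform among those from which the given secrets are read off. -/
noncomputable def protocol (hD : IsAdditiveScheme A t D) (φ : V ≃ (Fin K → F))
    (ψ : ∀ j, W j ≃ (Fin (r j) → F)) : Protocol F A r where
  h := n * K
  store := nodeShares n K
  enc s :=
    have := hD.nonempty_fiber ψ s
    (PMF.uniformOfFintype {y // (fun j => ψ j (D y j)) = s}).map fun y => shares φ y.1
  dec j := Function.extend (fun y => view (nodeShares n K) (A j) (shares φ y))
    (fun y => ψ j (D y j)) fun _ => ψ j 0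

theorem correct_protocol (hD : IsAdditiveScheme A t D) (φ : V ≃ (Fin K → F))
    (ψ : ∀ j, W j ≃ (Fin (r j) → F)) : (hD.protocol φ ψ).Correct := by
  intro s y hy j
  obtain ⟨⟨y, hys⟩, -, rfl⟩ := (PMF.mem_support_map_iff _ _ _).1 hy
  have hfactors : Function.FactorsThrough (fun y => ψ j (D y j))
      fun y => view (nodeShares n K) (A j) (shares φ y) := by
    intro y y' h
    have hsub := hD.apply_eq_zero j (y - y') fun i hi => sub_eq_zero.2 (view_shares_eq_iff.1 h i hi)
    rw [map_sub, Pi.sub_apply, sub_eq_zero] at hsub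
    exact congrArg (ψ j) hsub
  exact (hfactors.extend_apply (fun _ => ψ j 0) y).trans (congrFun hys j)

variable [Fintype F] [Nonempty F]

theorem joint_protocol (hD : IsAdditiveScheme A t D) (φ : V ≃ (Fin K → F))
    (ψ : ∀ j, W j ≃ (Fin (r j) → F)) :
    (hD.protocol φ ψ).joint = (PMF.uniformOfFintype (Fin n → V)).map fun y =>
      (fun j => ψ j (D y j), shares φ y) := by
  classical
  have hfiber : ∀ s s' : Secrets F r, Fintype.card {y // (fun j => ψ j (D y j)) = s} =
      Fintype.card {y // (fun j => ψ j (D y j)) = s'} := by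
    have hD' : ∀ s y, (fun j => ψ j (D y j)) = s ↔ D y = fun j => (ψ j).symm (s j) := fun s y => by
      simp only [funext_iff, Equiv.eq_symm_apply]
    simp only [hD']
    exact fun s s' => card_fiber_eq_of_surjective hD.surjective _ _
  have := hD.nonempty_fiber ψ
  rw [← uniformOfFintype_bind_fiber (fun y j => ψ j (D y j)) hfiber, PMF.map_bind]
  refine congrArg _ (funext fun s => ?_)
  simp only [protocol, PMF.map_comp]
  refine congrArg (PMF.map · _) (funext fun y => ?_)
  exact Prod.ext y.2.symm rfl

theorem weaklySecure_protocol (hD : IsAdditiveScheme A t D) (φ : V ≃ (Fin K → F))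
    (ψ : ∀ j, W j ≃ (Fin (r j) → F)) : (hD.protocol φ ψ).WeaklySecure t := by
  refine Protocol.weaklySecure_of_map_joint_eq_prodPMF fun S hS l hl => ?_
  have : Fintype (W l) := Fintype.ofEquiv _ (ψ l).symm
  let g : (S.biUnion A → V) → visible (nodeShares n K) (S.biUnion A) → F :=
    fun u k => φ (u ⟨k.1.divNat, mem_visible_nodeShares.1 k.2⟩) k.1.modNat
  refine ⟨(PMF.uniformOfFintype (W l)).map (ψ l), (PMF.uniformOfFintype _).map g, ?_⟩
  rw [joint_protocol]
  refine (PMF.map_comp _ _ _).trans (Eq.trans ?_ (map_prodMap_prodPMF _ _ _ _))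
  rw [← hD.map_apply_restrict hS hl]
  exact (PMF.map_comp (fun y => (D y l, (S.biUnion A).restrict y)) _ (Prod.map (ψ l) g)).symm

end IsAdditiveScheme

theorem isProtocolRate_of_isAdditiveScheme {F V : Type*} [Fintype F] [Nonempty F] [AddGroup V]
    [Fintype V] {W : Fin m → Type*} [∀ j, AddGroup (W j)] [∀ j, Fintype (W j)]
    {D : (Fin n → V) →+ ∀ j, W j} (hD : IsAdditiveScheme A t D) {K : ℕ} (hK : 0 < K)
    {r : Fin m → ℕ} (hV : Fintype.card V = Fintype.card F ^ K)
    (hW : ∀ j, Fintype.card (W j) = Fintype.card F ^ r j) :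
    IsProtocolRate F A t fun j => (r j : ℝ) / K := by
  let φ : V ≃ (Fin K → F) := Fintype.equivOfCardEq (by simp [hV])
  let ψ : ∀ j, W j ≃ (Fin (r j) → F) := fun j => Fintype.equivOfCardEq (by simp [hW j])
  exact ⟨K, r, hD.protocol φ ψ, hK, card_nodeShares_le, hD.correct_protocol φ ψ,
    hD.weaklySecure_protocol φ ψ, fun _ => rfl⟩

end AdditiveScheme

theorem exists_injective_of_forall_sum_le {ι α : Type*} [DecidableEq α] {A : ι → Finset α}
    {r : ι → ℕ} {K : ℕ} (h : ∀ S : Finset ι, ∑ j ∈ S, r j ≤ K * (S.biUnion A).card) :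
    ∃ f : (Σ j, Fin (r j)) → α × Fin K, Function.Injective f ∧ ∀ c, (f c).1 ∈ A c.1 := by
  classical
  have hhall : ∀ C : Finset (Σ j, Fin (r j)),
      C.card ≤ (C.biUnion fun c => A c.1 ×ˢ (Finset.univ : Finset (Fin K))).card := by
    intro C
    have hC : C ⊆ (C.image Sigma.fst).sigma fun _ => Finset.univ := fun c hc =>
      Finset.mem_sigma.2 ⟨Finset.mem_image_of_mem _ hc, Finset.mem_univ _⟩
    have hunion : C.biUnion (fun c => A c.1 ×ˢ (Finset.univ : Finset (Fin K))) =
        (C.image Sigma.fst).biUnion A ×ˢ Finset.univ := by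
      ext x
      simp
    calc C.card ≤ ∑ j ∈ C.image Sigma.fst, r j := by
          simpa only [Finset.card_sigma, Finset.card_univ, Fintype.card_fin] using
            Finset.card_le_card hC
      _ ≤ K * ((C.image Sigma.fst).biUnion A).card := h _
      _ = _ := by rw [hunion, Finset.card_product, Finset.card_univ, Fintype.card_fin, mul_comm]
  obtain ⟨f, hf, hmem⟩ := (Finset.all_card_le_biUnion_card_iff_exists_injective _).1 hhall
  exact ⟨f, hf, fun c => (Finset.mem_product.1 (hmem c)).1⟩

section MatrixScheme

open scoped Matrix

variable {n m t K : ℕ} {A : Fin m → Finset (Fin n)} {r : Fin m → ℕ} {E : Type*}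

/-- The matrix `G`, whose columns are the symbols of the secrets, as a homomorphism that reads the
secrets off the contents of the nodes, `K` symbols in each node. -/
def secretHom [Semiring E] (G : Matrix (Fin n × Fin K) (Σ j, Fin (r j)) E) :
    (Fin n → Fin K → E) →+ ∀ j, Fin (r j) → E where
  toFun y j a := (Function.uncurry y ᵥ* G) ⟨j, a⟩
  map_zero' := by
    funext j a
    exact congrFun (Matrix.zero_vecMul G) ⟨j, a⟩
  map_add' y y' := by
    funext j a
    exact congrFun (Matrix.add_vecMul G (Function.uncurry y) (Function.uncurry y')) ⟨j, a⟩

theorem IsGeneric.isAdditiveScheme [Field E] {G : Matrix (Fin n × Fin K) (Σ j, Fin (r j)) E}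
    (hG : IsGeneric (fun i c => i.1 ∈ A c.1) G)
    (hsec : ∀ j, ∀ S : Finset (Fin m), j ∉ S → S.card = t → r j ≤ K * (A j \ S.biUnion A).card)
    (hsum : ∀ S : Finset (Fin m), ∑ j ∈ S, r j ≤ K * (S.biUnion A).card) :
    IsAdditiveScheme A t (secretHom G) where
  surjective w := by
    obtain ⟨f, hf, hfA⟩ := exists_injective_of_forall_sum_le hsum
    obtain ⟨y, -, hy⟩ := hG.exists_vecMul_eq hf Function.injective_id hfA fun c => w c.1 c.2
    exact ⟨Function.curry y, funext fun j => funext fun a => hy ⟨j, a⟩⟩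
  apply_eq_zero j y hy := funext fun a => Finset.sum_eq_zero fun i _ => by
    by_cases hi : i.1 ∈ A j
    · exact mul_eq_zero_of_left (congrFun (hy i.1 hi) i.2) _
    · exact mul_eq_zero_of_right _ (hG.eq_zero i ⟨j, a⟩ hi)
  secure S hS l hl w := by
    have hcard : Fintype.card (Fin (r l)) ≤ Fintype.card (↥(A l \ S.biUnion A) × Fin K) := by
      rw [Fintype.card_prod, Fintype.card_coe, Fintype.card_fin, Fintype.card_fin, mul_comm]
      exact hsec l S hl hS
    obtain ⟨f⟩ := Function.Embedding.nonempty_of_card_le hcard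
    have hf : Function.Injective fun a => ((f a).1.1, (f a).2) :=
      (Subtype.val_injective.prodMap Function.injective_id).comp f.injective
    have hg : Function.Injective fun a => (⟨l, a⟩ : Σ j, Fin (r j)) :=
      sigma_mk_injective (β := fun j => Fin (r j))
    obtain ⟨y, hy, hyw⟩ :=
      hG.exists_vecMul_eq hf hg (fun a => (Finset.mem_sdiff.1 (f a).1.2).1) w
    refine ⟨Function.curry y, fun i hi => funext fun κ => hy (i, κ) ?_, funext hyw⟩
    rintro ⟨a, ha⟩
    exact (Finset.mem_sdiff.1 (f a).1.2).2 ((Prod.mk.inj ha).1 ▸ hi)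

/-- An element of the extension field `E` is stored as `[E : F]` symbols of `F`, which multiplies
the node size and the lengths of the secrets by the same factor. -/
theorem isProtocolRate_of_mem_rateRegion {F : Type*} [Field F] [Fintype F] (hK : 0 < K)
    (hr : (fun j => (r j : ℝ) / K) ∈ rateRegion A t) :
    IsProtocolRate F A t fun j => (r j : ℝ) / K := by
  obtain ⟨hsec, hsum⟩ := (natCast_div_mem_rateRegion_iff hK).1 hr
  obtain ⟨E, _, G, hG⟩ := exists_isGeneric F
    fun (i : Fin n × Fin K) (c : Σ j, Fin (r j)) => i.1 ∈ A c.1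
  have := Module.finite_of_finite F (M := E)
  have := Fintype.ofFinite E
  have hd : 0 < Module.finrank F E := Module.finrank_pos
  have hpow : ∀ k, Fintype.card (Fin k → E) = Fintype.card F ^ (k * Module.finrank F E) := by
    intro k
    rw [Fintype.card_fun, Fintype.card_fin, Module.card_eq_pow_finrank (K := F), ← pow_mul,
      mul_comm]
  have hrate := isProtocolRate_of_isAdditiveScheme (F := F) (hG.isAdditiveScheme hsec hsum)
    (Nat.mul_pos hK hd) (hpow K) fun j => hpow (r j)
  simpa only [Nat.cast_mul, mul_div_mul_right _ _ (Nat.cast_ne_zero (R := ℝ).2 hd.ne')] using hrate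

end MatrixScheme

theorem capacityRegion_eq_rateRegion (F : Type*) [Field F] [Fintype F] {n m : ℕ}
    (A : Fin m → Finset (Fin n)) (t : ℕ) : capacityRegion F A t = rateRegion A t := by
  refine (closure_minimal (fun R hR => hR.mem_rateRegion) isClosed_rateRegion).antisymm ?_
  refine rateRegion_subset_closure.trans (closure_mono ?_)
  rintro R ⟨hR, K, r, hK, rfl⟩
  exact isProtocolRate_of_mem_rateRegion hK hR

end DMUSS

theorem theorem1 {F : Type*} [Field F] [Fintype F] (n m t : ℕ) (A : Fin m → Finset (Fin n)) :
    DMUSS.capacityRegion F A t =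
      convexHull ℝ {R : Fin m → ℝ |
        (∀ j, 0 ≤ R j) ∧
        (∀ j, ∀ S : Finset (Fin m), j ∉ S → S.card = t →
          R j ≤ ((A j \ S.biUnion A).card : ℝ)) ∧
        (∀ S : Finset (Fin m), ∑ i ∈ S, R i ≤ ((S.biUnion A).card : ℝ))} := by
  rw [DMUSS.capacityRegion_eq_rateRegion]
  exact DMUSS.convex_rateRegion.convexHull_eq.symm
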